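/- Let $l>0$, $\alpha>-\tfrac12$, and let $n\ge 0$, $q\ge 1$ be integers. Let $G^{(\alpha)}_m$ denote the Gegenbauer polynomials on $[-1,1]$ normalized by $G^{(\alpha)}_m(1)=1$, that is, $G_0^{(\alpha)}=1$, $G_1^{(\alpha)}(x)=x$ and $(j+2\alpha)G^{(\alpha)}_{j+1}=2(j+\alpha)xG^{(\alpha)}_j-jG^{(\alpha)}_{j-1}$ for $j\ge1$, and let $x_0<x_1<\dots<x_n$ be the zeros of the shifted polynomial $G^{(\alpha)}_{n+1}(2x/l-1)$ (the shifted Gegenbauer--Gauss nodes on $[0,l]$). Put $z_j=2x_j/l-1$, let $\mathcal L_j$ be the Lagrange interpolating polynomials of the nodes $z_0,\dots,z_n$, and define the $q$-th order barycentric Gegenbauer integration matrix and its shifted version by $$p^{(q)}_{ij}=\frac{(z_i-z_j)^{q-1}}{(q-1)!}\int_{-1}^{z_i}\mathcal L_j(t)\,dt,\qquad {}_lp^{(q)}_{ij}=\Big(\frac l2\Big)^q p^{(q)}_{ij},\qquad 0\le i,j\le n .$$ Let $f\in C^{n+1}[0,l]$ satisfy $\|f^{(k)}\|_{L^\infty[0,l]}\le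 A_{\max}$ for all $k=0,\dots,n+1$, where $A_{\max}>0$. Let $$E_i=\int_0^{x_i}\int_0^{\sigma_{q-1}}\cdots\int_0^{\sigma_1}f(\sigma_0)\,d\sigma_0\cdots d\sigma_{q-1}-\sum_{j=0}^n{}_lp^{(q)}_{ij}f(x_j)$$ be the truncation error at $x_i$ of the $q$-th order barycentric shifted Gegenbauer quadrature (BSGQ). Then there exist numbers $\zeta_0,\dots,\zeta_n\in(0,l)$ such that, for every $i=0,\dots,n$, $$|E_i|\le\frac{2^{-n}A_{\max}\,l^{\,n+1}\,n_{\max,i}\,x_i\,\Gamma(1+\alpha)\,\Gamma(1+n+2\alpha)}{(n+1)!\,(q-1)!\,\Gamma(1+n+\alpha)\,\Gamma(1+2\alpha)}\;\vartheta_n^{(\alpha)},$$ where $$\vartheta_n^{(\alpha)}=\begin{cases}1,&\alpha\ge0,\\[4pt] \dfrac{2|\alpha|\,\Big|\dbinom{n/2+\alpha}{n/2}\Big|\,(n+1)!\,|\Gamma(2\alpha)|}{\sqrt{(1+n)(1+n+2\alpha)}\,\Gamma(1+n+2\alpha)},&-\tfrac12<\alpha<0,\ n\text{ even},\\[12pt]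 \dfrac{\Big|\dbinom{(n-1)/2+\alpha}{(n+1)/2}\Big|\,(n+1)!\,|\Gamma(2\alpha)|}{\Gamma(1+n+2\alpha)},&-\tfrac12<\alpha<0,\ n\text{ odd},\end{cases}$$ $$n_{\max,i}=\max\Big\{(q-1)!,\ \sup_{0\le k\le n+1}(q-1)_{n-k+1}\,|x_i-\zeta_i|^{\,q-n+k-2}\Big\}.$$ Here $\binom{a}{m}=a(a-1)\cdots(a-m+1)/m!$ is the generalized binomial coefficient, $(a)_m=a(a-1)\cdots(a-m+1)$ is the falling factorial, and terms of the supremum with $n-k+1>q-1$ (whose falling factorial vanishes) count as $0$. -/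

import Mathlib

open Polynomial

noncomputable section

/-- The Gegenbauer polynomials on `[-1, 1]` in the normalization `G_n^{(α)}(1) = 1` (so that `α = 0`
gives the Chebyshev polynomials of the first kind, `α = 1/2` the Legendre polynomials):
`G_0 = 1`, `G_1 = x`, `(j + 2α) G_{j+1} = 2 (j + α) x G_j - j G_{j-1}` for `j ≥ 1`. -/
def gegenbauer (α : ℝ) : ℕ → ℝ[X]
  | 0 => 1
  | 1 => X
  | (j + 2) =>
      C (2 * (((j : ℝ) + 1) + α) / (((j : ℝ) + 1) + 2 * α)) * X * gegenbauer α (j + 1)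
        - C (((j : ℝ) + 1) / (((j : ℝ) + 1) + 2 * α)) * gegenbauer α j

/-- The shifted Gegenbauer polynomials on `[0, l]`: `G_{l,n}^{(α)}(x) = G_n^{(α)}(2 x / l - 1)`. -/
def shiftedGegenbauer (l α : ℝ) (n : ℕ) : ℝ[X] :=
  (gegenbauer α n).comp (C (2 / l) * X - 1)

/-- `x 0 < x 1 < ⋯ < x n` are exactly the zeros of the shifted Gegenbauer polynomial of
degree `n + 1`: the shifted Gegenbauer–Gauss nodes on `[0, l]`, sorted ascendingly. -/
def IsSGGNodes (l α : ℝ) (n : ℕ) (x : Fin (n + 1) → ℝ) : Prop :=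
  StrictMono x ∧ Set.range x = {t : ℝ | (shiftedGegenbauer l α (n + 1)).IsRoot t}

/-- The `q`-fold integral
`∫_0^{t} ∫_0^{σ_{q-1}} ⋯ ∫_0^{σ_1} f(σ_0) dσ_0 ⋯ dσ_{q-1}` (and `f t` for `q = 0`). -/
def foldIntegral (f : ℝ → ℝ) : ℕ → ℝ → ℝ
  | 0, t => f t
  | (q + 1), t => ∫ σ in (0 : ℝ)..t, foldIntegral f q σ

/-- The fundamental Lagrange interpolating polynomial of the nodes `z`, i.e. the polynomial of
degree `n` with value `δ_{jk}` at `z k`. See `lagrangeBasis_eq_barycentric` for its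
barycentric representation. -/
def lagrangeBasis {n : ℕ} (z : Fin (n + 1) → ℝ) (j : Fin (n + 1)) : ℝ[X] :=
  Lagrange.basis Finset.univ z j

/-- Away from the nodes, the Lagrange polynomials are given by the barycentric formula
`(w_j / (y - z_j)) / ∑_k w_k / (y - z_k)` with barycentric weights `w_k`. -/
theorem lagrangeBasis_eq_barycentric {n : ℕ} {z : Fin (n + 1) → ℝ} (hz : StrictMono z)
    (j : Fin (n + 1)) {y : ℝ} (hy : ∀ k, y ≠ z k) :
    (lagrangeBasis z j).eval y =
      (Lagrange.nodalWeight Finset.univ z j / (y - z j)) /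
        ∑ k, Lagrange.nodalWeight Finset.univ z k / (y - z k) := by
  have hinj : Set.InjOn z (Finset.univ : Finset (Fin (n + 1))) := hz.injective.injOn
  have hne : (Finset.univ : Finset (Fin (n + 1))).Nonempty := ⟨0, Finset.mem_univ _⟩
  have h0 := Lagrange.sum_nodalWeight_mul_inv_sub_ne_zero hinj (fun i _ => hy i) hne
  have hs := congrArg (Polynomial.eval y) (Lagrange.sum_basis hinj hne)
  rw [Polynomial.eval_finsetSum] at hs
  simp only [Lagrange.eval_basis_not_at_node (Finset.mem_univ _) (hy _), Polynomial.eval_one] at hs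
  rw [← Finset.mul_sum] at hs
  rw [lagrangeBasis, Lagrange.eval_basis_not_at_node (Finset.mem_univ _) (hy _)]
  simp only [div_eq_mul_inv] at h0 hs ⊢
  rw [eq_mul_inv_iff_mul_eq₀ h0]
  linear_combination (Lagrange.nodalWeight Finset.univ z j * (y - z j)⁻¹) * hs

/-- The `q`-th order barycentric Gegenbauer integration matrix on `[-1, 1]`, `q ≥ 1`, at nodes `z`:
the first-order entries are `∫_{-1}^{z_i}` of the `j`-th Lagrange polynomial, and the `q`-th order
entries are obtained from these through the factor `(z_i - z_j)^{q-1} / (q-1)!`. -/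
def gim {n : ℕ} (z : Fin (n + 1) → ℝ) (q : ℕ) : Matrix (Fin (n + 1)) (Fin (n + 1)) ℝ :=
  Matrix.of fun i j =>
    (z i - z j) ^ (q - 1) / ((q - 1).factorial : ℝ) *
      ∫ t in (-1 : ℝ)..(z i), (lagrangeBasis z j).eval t

/-- The `q`-th order barycentric shifted Gegenbauer integration matrix at the nodes `x` in `[0, l]`:
`(l/2)^q` times the matrix of order `q` at the corresponding nodes `2 x_j / l - 1` in `[-1, 1]`. -/
def bsgim (l : ℝ) {n : ℕ} (x : Fin (n + 1) → ℝ) (q : ℕ) :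
    Matrix (Fin (n + 1)) (Fin (n + 1)) ℝ :=
  (l / 2) ^ q • gim (fun j => 2 * x j / l - 1) q

/-- The truncation error of the `q`-th order barycentric shifted Gegenbauer quadrature at `x i`:
the `q`-fold integral of `f` up to `x i` minus the `i`-th row of the integration matrix times
the vector of the values of `f` at the nodes. -/
def bsgqError (l : ℝ) {n : ℕ} (x : Fin (n + 1) → ℝ) (q : ℕ) (f : ℝ → ℝ) (i : Fin (n + 1)) : ℝ :=
  foldIntegral f q (x i) - (bsgim l x q).mulVec (fun j => f (x j)) i

/-- `n_max = max {(q-1)!, sup_{0 ≤ k ≤ n+1} (q-1)_{n-k+1} |x - ζ|^{q-n+k-2}}`, where `(a)_m` is the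
falling factorial `a (a-1) ⋯ (a-m+1)`; the exponent is an integer, and a term with a negative
exponent vanishes because its falling factorial does. -/
def nMax (n q : ℕ) (x ζ : ℝ) : ℝ :=
  max ((q - 1).factorial : ℝ)
    (⨆ k : Fin (n + 2), (descPochhammer ℝ (n + 1 - (k : ℕ))).eval ((q : ℝ) - 1) *
      |x - ζ| ^ ((q : ℤ) - (n : ℤ) + ((k : ℕ) : ℤ) - 2))

/-- The factor that distinguishes `α ≥ 0`, `-1/2 < α < 0` with `n` even, and `-1/2 < α < 0` with `n`
odd. `Ring.choose` is the generalized binomial coefficient `a (a-1) ⋯ (a-m+1) / m!`. -/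
def caseFactor (α : ℝ) (n : ℕ) : ℝ :=
  if 0 ≤ α then 1
  else if Even n then
    2 * |α| * |Ring.choose ((n : ℝ) / 2 + α) (n / 2)| * ((n + 1).factorial : ℝ)
        * |Real.Gamma (2 * α)|
      / (Real.sqrt ((1 + (n : ℝ)) * (1 + (n : ℝ) + 2 * α)) * Real.Gamma (1 + (n : ℝ) + 2 * α))
  else
    |Ring.choose (((n : ℝ) - 1) / 2 + α) ((n + 1) / 2)| * ((n + 1).factorial : ℝ)
        * |Real.Gamma (2 * α)|
      / Real.Gamma (1 + (n : ℝ) + 2 * α)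

end

/-! By the Gegenbauer differential equation, Sonin's function of a Gegenbauer polynomial `u` is
monotone in `|x|` on `[-1, 1]`, in a direction given by the sign of `α`. Hence `|u|` is at most `1`
there when `0 ≤ α`, and is controlled by `u 0` and `u' 0` when `α < 0`; these central values are the
source of the case distinction in `caseFactor`. Dividing the shifted Gegenbauer polynomial by its
leading coefficient gives the nodal polynomial of the nodes, which is thus bounded on `[0, l]`.

By Cauchy's formula for repeated integration, and because a quadrature weight is the integral of a
Lagrange polynomial times `(x_i - x_j)^{q-1} / (q-1)!`, the truncation error at `x_i` is
`1 / (q-1)!` times the integral over `[0, x_i]` of the interpolation remainder of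
`s ↦ (x_i - s)^{q-1} f s`. The mean value theorem replaces this integral by `x_i` times one value of
the remainder, which is the nodal polynomial times a derivative of order `n + 1` divided by
`(n + 1)!`. Leibniz' rule bounds that derivative by `2^{n+1} A_max n_max`.
-/

section GeneralizedBinomial

variable {R : Type*} [CommRing R] [BinomialRing R]

theorem ringChoose_add_one_succ_mul (a : R) (k : ℕ) :
    Ring.choose (a + 1) (k + 1) * (k + 1) = (a + 1) * Ring.choose a k := by
  have h := Ring.choose_smul_choose (a + 1) (Nat.le_add_left 1 k)
  rw [Ring.choose_one_right, Nat.choose_one_right, Nat.cast_one, add_sub_cancel_right,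
    Nat.add_sub_cancel, nsmul_eq_mul, Nat.cast_succ] at h
  rw [← h, mul_comm]

theorem ringChoose_add_one_mul (a : R) (k : ℕ) :
    Ring.choose (a + 1) k * (a + 1 - k) = (a + 1) * Ring.choose a k := by
  have h := Ring.choose_smul_choose (a + 1) (Nat.le_add_right k 1)
  rw [Nat.choose_succ_self_right, Nat.add_sub_cancel_left, Ring.choose_one_right, nsmul_eq_mul,
    Nat.cast_succ, mul_comm, ringChoose_add_one_succ_mul] at h
  exact h.symm

end GeneralizedBinomial

section Gegenbauer

variable {α : ℝ}

theorem add_one_add_two_mul_pos (hα : -(1 / 2 : ℝ) < α) (m : ℕ) :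
    0 < (m : ℝ) + 1 + 2 * α := by
  have : (0 : ℝ) ≤ m := m.cast_nonneg
  linarith

theorem mul_add_two_mul_pos (hα : -(1 / 2 : ℝ) < α) {m : ℕ} (hm : m ≠ 0) :
    0 < (m : ℝ) * (m + 2 * α) := by
  obtain ⟨k, rfl⟩ := Nat.exists_eq_succ_of_ne_zero hm
  have := add_one_add_two_mul_pos hα k
  push_cast
  positivity

theorem gegenbauer_recurrence (hα : -(1 / 2 : ℝ) < α) (m : ℕ) :
    ((m : ℝ[X]) + 1 + 2 * C α) * gegenbauer α (m + 2) =
      2 * ((m : ℝ[X]) + 1 + C α) * X * gegenbauer α (m + 1) -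
        ((m : ℝ[X]) + 1) * gegenbauer α m := by
  have hne := (add_one_add_two_mul_pos hα m).ne'
  have hleft : (m : ℝ[X]) + 1 + 2 * C α = C ((m : ℝ) + 1 + 2 * α) := by simp [map_ofNat]
  have hmid : 2 * ((m : ℝ[X]) + 1 + C α) = C (2 * ((m : ℝ) + 1 + α)) := by simp [map_ofNat]
  have hright : (m : ℝ[X]) + 1 = C ((m : ℝ) + 1) := by simp
  rw [gegenbauer, hleft, hmid, hright, mul_sub, ← mul_assoc, ← mul_assoc, ← mul_assoc, ← C_mul,
    ← C_mul, mul_div_cancel₀ _ hne, mul_div_cancel₀ _ hne]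

theorem gegenbauer_recurrence_eval (hα : -(1 / 2 : ℝ) < α) (m : ℕ) (x : ℝ) :
    ((m : ℝ) + 1 + 2 * α) * (gegenbauer α (m + 2)).eval x =
      2 * ((m : ℝ) + 1 + α) * x * (gegenbauer α (m + 1)).eval x -
        ((m : ℝ) + 1) * (gegenbauer α m).eval x := by
  simpa using congrArg (eval x) (gegenbauer_recurrence hα m)

theorem one_sub_X_sq_mul_derivative_gegenbauer_succ (hα : -(1 / 2 : ℝ) < α) (m : ℕ) :
    (1 - X ^ 2) * derivative (gegenbauer α (m + 1)) =
      ((m : ℝ[X]) + 1) * (gegenbauer α m - X * gegenbauer α (m + 1)) := by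
  have hpos (k : ℕ) : (k : ℝ[X]) + 1 + 2 * C α ≠ 0 := by
    have := C_ne_zero.mpr (add_one_add_two_mul_pos hα k).ne'
    simpa [map_ofNat] using this
  induction m using Nat.twoStepInduction with
  | zero =>
    simp only [gegenbauer, derivative_X, Nat.cast_zero]
    ring
  | one =>
    have hrec := gegenbauer_recurrence hα 0
    have hderiv := congrArg derivative hrec
    apply mul_left_cancel₀ (hpos 0)
    simp only [gegenbauer.eq_1, gegenbauer.eq_2, derivative_mul, derivative_sub, derivative_add,
      derivative_C, derivative_X, derivative_one, derivative_ofNat,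
      Nat.cast_zero, Nat.cast_one, zero_add] at hrec hderiv ⊢
    linear_combination (1 - X ^ 2) * hderiv + 2 * X * hrec
  | more m ih₀ ih₁ =>
    have hrec := gegenbauer_recurrence hα (m + 1)
    have hderiv := congrArg derivative hrec
    apply mul_left_cancel₀ (hpos (m + 1))
    simp only [derivative_mul, derivative_sub, derivative_add, derivative_C, derivative_X,
      derivative_natCast, derivative_one, derivative_ofNat, Nat.cast_add, Nat.cast_one,
      Nat.cast_ofNat] at hrec hderiv ih₁ ⊢
    linear_combination (1 - X ^ 2) * hderiv + 2 * ((m : ℝ[X]) + 2 + C α) * X * ih₁ -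
      ((m : ℝ[X]) + 2) * (ih₀ + gegenbauer_recurrence hα m) + ((m : ℝ[X]) + 3) * X * hrec

theorem one_sub_X_sq_mul_derivative_gegenbauer (hα : -(1 / 2 : ℝ) < α) (m : ℕ) :
    (1 - X ^ 2) * derivative (gegenbauer α m) =
      ((m : ℝ[X]) + 2 * C α) * (X * gegenbauer α m - gegenbauer α (m + 1)) := by
  cases m with
  | zero => simp [gegenbauer]
  | succ m =>
    push_cast
    linear_combination one_sub_X_sq_mul_derivative_gegenbauer_succ hα m +
      gegenbauer_recurrence hα m

theorem gegenbauer_differential_equation (hα : -(1 / 2 : ℝ) < α) (m : ℕ) :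
    (1 - X ^ 2) * derivative (derivative (gegenbauer α m)) -
      (1 + 2 * C α) * X * derivative (gegenbauer α m) +
      (m : ℝ[X]) * ((m : ℝ[X]) + 2 * C α) * gegenbauer α m = 0 := by
  have hlower := one_sub_X_sq_mul_derivative_gegenbauer_succ hα m
  have hraise := one_sub_X_sq_mul_derivative_gegenbauer hα m
  have hderiv := congrArg derivative hraise
  have hne : (1 - X ^ 2 : ℝ[X]) ≠ 0 := fun h => by
    simpa using congrArg (eval 0) h
  apply mul_left_cancel₀ hne
  simp only [derivative_mul, derivative_sub, derivative_add, derivative_C, derivative_X,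
    derivative_natCast, derivative_one, derivative_ofNat, derivative_X_sq, map_ofNat] at hderiv
  linear_combination (1 - X ^ 2) * hderiv - ((m : ℝ[X]) + 2 * C α) * hlower +
    ((m : ℝ[X]) + 1) * X * hraise

theorem gegenbauer_eval_neg (m : ℕ) (x : ℝ) :
    (gegenbauer α m).eval (-x) = (-1) ^ m * (gegenbauer α m).eval x := by
  induction m using Nat.twoStepInduction with
  | zero => simp [gegenbauer]
  | one => simp [gegenbauer]
  | more m h₀ h₁ =>
    simp only [gegenbauer, eval_sub, eval_mul, eval_C, eval_X, h₀, h₁]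
    ring

theorem abs_gegenbauer_eval_abs (m : ℕ) (x : ℝ) :
    |(gegenbauer α m).eval (|x|)| = |(gegenbauer α m).eval x| := by
  rcases abs_choice x with h | h
  · rw [h]
  · rw [h, gegenbauer_eval_neg, abs_mul, abs_neg_one_pow, one_mul]

theorem gegenbauer_eval_zero_of_odd {m : ℕ} (hm : Odd m) : (gegenbauer α m).eval 0 = 0 := by
  have h := gegenbauer_eval_neg (α := α) m 0
  rw [neg_zero, hm.neg_one_pow] at h
  linarith

theorem gegenbauer_eval_one (hα : -(1 / 2 : ℝ) < α) (m : ℕ) : (gegenbauer α m).eval 1 = 1 := by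
  induction m using Nat.twoStepInduction with
  | zero => simp [gegenbauer]
  | one => simp [gegenbauer]
  | more m h₀ h₁ =>
    have hrec := gegenbauer_recurrence_eval hα m 1
    rw [h₀, h₁] at hrec
    apply mul_left_cancel₀ (add_one_add_two_mul_pos hα m).ne'
    linear_combination hrec

theorem one_le_gegenbauer_eval_and_le_succ (hα : -(1 / 2 : ℝ) < α) {x : ℝ} (hx : 1 ≤ x) (m : ℕ) :
    1 ≤ (gegenbauer α m).eval x ∧ (gegenbauer α m).eval x ≤ (gegenbauer α (m + 1)).eval x := by
  induction m with
  | zero => simpa [gegenbauer] using hx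
  | succ m ih =>
    obtain ⟨hone, hle⟩ := ih
    refine ⟨hone.trans hle, le_of_mul_le_mul_left ?_ (add_one_add_two_mul_pos hα m)⟩
    have hcoef : 0 ≤ 2 * ((m : ℝ) + 1 + α) := by linarith [add_one_add_two_mul_pos hα m]
    calc ((m : ℝ) + 1 + 2 * α) * (gegenbauer α (m + 1)).eval x
        = 2 * ((m : ℝ) + 1 + α) * (1 * (gegenbauer α (m + 1)).eval x) -
            ((m : ℝ) + 1) * (gegenbauer α (m + 1)).eval x := by ring
      _ ≤ 2 * ((m : ℝ) + 1 + α) * (x * (gegenbauer α (m + 1)).eval x) -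
            ((m : ℝ) + 1) * (gegenbauer α m).eval x := by
          gcongr
          linarith
      _ = ((m : ℝ) + 1 + 2 * α) * (gegenbauer α (m + 2)).eval x := by
          rw [gegenbauer_recurrence_eval hα m x]
          ring

theorem abs_lt_one_of_isRoot_gegenbauer (hα : -(1 / 2 : ℝ) < α) {m : ℕ} {x : ℝ}
    (hx : (gegenbauer α m).IsRoot x) : |x| < 1 := by
  by_contra! h
  have hone := (one_le_gegenbauer_eval_and_le_succ hα h m).1
  have hzero := abs_gegenbauer_eval_abs (α := α) m x
  rw [hx.eq_zero, abs_zero, abs_eq_zero] at hzero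
  linarith

/-- Sonin's function `u² + (1 - x²) / (m (m + 2α)) u'²` of the Gegenbauer polynomial `u` of
degree `m`: it dominates `u²` on `[-1, 1]`, and its derivative has the sign of `α x`. -/
noncomputable def soninFunction (α : ℝ) (m : ℕ) (x : ℝ) : ℝ :=
  (gegenbauer α m).eval x ^ 2 +
    (1 - x ^ 2) / (m * (m + 2 * α)) * (derivative (gegenbauer α m)).eval x ^ 2

theorem hasDerivAt_soninFunction (hα : -(1 / 2 : ℝ) < α) {m : ℕ} (hm : m ≠ 0) (x : ℝ) :
    HasDerivAt (soninFunction α m)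
      (4 * α * x / (m * (m + 2 * α)) * (derivative (gegenbauer α m)).eval x ^ 2) x := by
  have hode : (1 - x ^ 2) * (derivative (derivative (gegenbauer α m))).eval x -
      (1 + 2 * α) * x * (derivative (gegenbauer α m)).eval x +
      m * (m + 2 * α) * (gegenbauer α m).eval x = 0 := by
    simpa using congrArg (eval x) (gegenbauer_differential_equation hα m)
  have hu := ((gegenbauer α m).hasDerivAt x).fun_pow 2
  have hu' := ((derivative (gegenbauer α m)).hasDerivAt x).fun_pow 2
  have hweight := ((hasDerivAt_pow 2 x).const_sub 1).div_const ((m : ℝ) * (m + 2 * α))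
  refine (hu.add (hweight.mul hu')).congr_deriv ?_
  have hne := (mul_add_two_mul_pos hα hm).ne'
  generalize (m : ℝ) * (m + 2 * α) = N at *
  simp only [Nat.cast_ofNat, Nat.add_one_sub_one, pow_one]
  field_simp
  linear_combination 2 * (derivative (gegenbauer α m)).eval x * hode

theorem sq_gegenbauer_eval_le_soninFunction_abs (hα : -(1 / 2 : ℝ) < α) {m : ℕ} (hm : m ≠ 0)
    {x : ℝ} (hx : |x| ≤ 1) : (gegenbauer α m).eval x ^ 2 ≤ soninFunction α m |x| := by
  have hweight : 0 ≤ 1 - |x| ^ 2 := sub_nonneg.mpr (pow_le_one₀ (abs_nonneg x) hx)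
  have hN := mul_add_two_mul_pos hα hm
  rw [soninFunction, ← sq_abs (eval (|x|) (gegenbauer α m)), abs_gegenbauer_eval_abs, sq_abs]
  exact le_add_of_nonneg_right (by positivity)

theorem monotoneOn_soninFunction (hα : 0 ≤ α) {m : ℕ} (hm : m ≠ 0) :
    MonotoneOn (soninFunction α m) (Set.Icc 0 1) := by
  have hderiv := hasDerivAt_soninFunction (by linarith : -(1 / 2 : ℝ) < α) hm
  refine monotoneOn_of_hasDerivWithinAt_nonneg (convex_Icc 0 1)
    (fun y _ => (hderiv y).continuousAt.continuousWithinAt)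
    (fun y _ => (hderiv y).hasDerivWithinAt) fun y hy => ?_
  rw [interior_Icc] at hy
  have := hy.1
  positivity

theorem antitoneOn_soninFunction (hα : -(1 / 2 : ℝ) < α) (hα₀ : α ≤ 0) {m : ℕ} (hm : m ≠ 0) :
    AntitoneOn (soninFunction α m) (Set.Icc 0 1) := by
  have hderiv := hasDerivAt_soninFunction hα hm
  refine antitoneOn_of_hasDerivWithinAt_nonpos (convex_Icc 0 1)
    (fun y _ => (hderiv y).continuousAt.continuousWithinAt)
    (fun y _ => (hderiv y).hasDerivWithinAt) fun y hy => ?_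
  rw [interior_Icc] at hy
  have hnum : 4 * α * y ≤ 0 := mul_nonpos_of_nonpos_of_nonneg (by linarith) hy.1.le
  exact mul_nonpos_of_nonpos_of_nonneg
    (div_nonpos_of_nonpos_of_nonneg hnum (mul_add_two_mul_pos hα hm).le) (sq_nonneg _)

theorem abs_gegenbauer_eval_le_one (hα : 0 ≤ α) (m : ℕ) {x : ℝ} (hx : |x| ≤ 1) :
    |(gegenbauer α m).eval x| ≤ 1 := by
  rcases eq_or_ne m 0 with rfl | hm
  · simp [gegenbauer]
  have hα' : -(1 / 2 : ℝ) < α := by linarith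
  rw [← sq_le_one_iff_abs_le_one]
  calc (gegenbauer α m).eval x ^ 2
      ≤ soninFunction α m |x| := sq_gegenbauer_eval_le_soninFunction_abs hα' hm hx
    _ ≤ soninFunction α m 1 := monotoneOn_soninFunction hα hm ⟨abs_nonneg x, hx⟩ (by simp) hx
    _ = 1 := by simp [soninFunction, gegenbauer_eval_one hα']

theorem sq_gegenbauer_succ_eval_le (hα : -(1 / 2 : ℝ) < α) (hα₀ : α ≤ 0) (m : ℕ) {x : ℝ}
    (hx : |x| ≤ 1) :
    (gegenbauer α (m + 1)).eval x ^ 2 ≤ (gegenbauer α (m + 1)).eval 0 ^ 2 +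
      ((m : ℝ) + 1) / (m + 1 + 2 * α) * (gegenbauer α m).eval 0 ^ 2 := by
  have hderiv : (derivative (gegenbauer α (m + 1))).eval 0 =
      ((m : ℝ) + 1) * (gegenbauer α m).eval 0 := by
    simpa using congrArg (eval 0) (one_sub_X_sq_mul_derivative_gegenbauer_succ hα m)
  have hpos := add_one_add_two_mul_pos hα m
  calc (gegenbauer α (m + 1)).eval x ^ 2
      ≤ soninFunction α (m + 1) |x| :=
        sq_gegenbauer_eval_le_soninFunction_abs hα m.succ_ne_zero hx
    _ ≤ soninFunction α (m + 1) 0 :=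
        antitoneOn_soninFunction hα hα₀ m.succ_ne_zero (by simp) ⟨abs_nonneg x, hx⟩ (abs_nonneg x)
    _ = _ := by
        rw [soninFunction, hderiv]
        push_cast
        field_simp
        ring

theorem abs_gegenbauer_eval_le_of_odd (hα : -(1 / 2 : ℝ) < α) (hα₀ : α ≤ 0) {m : ℕ} (hm : Odd m)
    {x : ℝ} (hx : |x| ≤ 1) :
    |(gegenbauer α (m + 1)).eval x| ≤ |(gegenbauer α (m + 1)).eval 0| := by
  rw [← sq_le_sq]
  simpa [gegenbauer_eval_zero_of_odd hm] using sq_gegenbauer_succ_eval_le hα hα₀ m hx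

theorem abs_gegenbauer_eval_le_of_even (hα : -(1 / 2 : ℝ) < α) (hα₀ : α ≤ 0) {m : ℕ} (hm : Even m)
    {x : ℝ} (hx : |x| ≤ 1) :
    |(gegenbauer α (m + 1)).eval x| ≤
      √(((m : ℝ) + 1) / (m + 1 + 2 * α)) * |(gegenbauer α m).eval 0| := by
  have hpos := add_one_add_two_mul_pos hα m
  refine abs_le_of_sq_le_sq ?_ (by positivity)
  rw [mul_pow, Real.sq_sqrt (by positivity), sq_abs]
  simpa [gegenbauer_eval_zero_of_odd hm.add_one] using sq_gegenbauer_succ_eval_le hα hα₀ m hx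

theorem two_mul_add_two_mul_ne_zero (hα : -(1 / 2 : ℝ) < α) (hα₀ : α ≠ 0) (k : ℕ) :
    2 * (k : ℝ) + 2 * α ≠ 0 := by
  rcases k with _ | k
  · simpa using hα₀
  · have : (0 : ℝ) ≤ k := k.cast_nonneg
    push_cast
    linarith

theorem gegenbauer_two_mul_eval_zero (hα : -(1 / 2 : ℝ) < α) (hα₀ : α ≠ 0) (k : ℕ) :
    (gegenbauer α (2 * k)).eval 0 * Real.Gamma (2 * k + 2 * α) =
      (-1) ^ k * Ring.choose ((k : ℝ) + α - 1) k * ((2 * k).factorial : ℝ) *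
        Real.Gamma (2 * α) := by
  induction k with
  | zero => simp [gegenbauer]
  | succ k ih =>
    have hrec := gegenbauer_recurrence_eval hα (2 * k) 0
    have hchoose := ringChoose_add_one_succ_mul ((k : ℝ) + α - 1) k
    have hpos := add_one_add_two_mul_pos hα (2 * k)
    have hΓ : Real.Gamma (2 * ((k + 1 : ℕ) : ℝ) + 2 * α) =
        (2 * k + 1 + 2 * α) * ((2 * k + 2 * α) * Real.Gamma (2 * k + 2 * α)) := by
      push_cast at hpos ⊢
      rw [← Real.Gamma_add_one (two_mul_add_two_mul_ne_zero hα hα₀ k),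
        show 2 * (k : ℝ) + 1 + 2 * α = 2 * k + 2 * α + 1 by ring,
        ← Real.Gamma_add_one (by linarith)]
      ring_nf
    rw [sub_add_cancel] at hchoose
    rw [hΓ, mul_add_one, show ((k + 1 : ℕ) : ℝ) + α - 1 = k + α by push_cast; ring,
      Nat.factorial_succ, Nat.factorial_succ, pow_succ]
    push_cast at hrec ⊢
    linear_combination (2 * k + 2 * α) * Real.Gamma (2 * k + 2 * α) * hrec -
      (2 * k + 1) * (2 * k + 2 * α) * ih +
      2 * (-1) ^ k * (2 * k + 1) * (2 * k).factorial * Real.Gamma (2 * α) * hchoose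

theorem gegenbauer_two_mul_eval_zero_mul_Gamma_add_one (hα : -(1 / 2 : ℝ) < α) (hα₀ : α ≠ 0)
    (k : ℕ) :
    (gegenbauer α (2 * k)).eval 0 * Real.Gamma (2 * k + 2 * α + 1) =
      (-1) ^ k * (2 * α * Ring.choose ((k : ℝ) + α) k) * ((2 * k).factorial : ℝ) *
        Real.Gamma (2 * α) := by
  have hchoose := ringChoose_add_one_mul ((k : ℝ) + α - 1) k
  rw [sub_add_cancel, add_sub_cancel_left] at hchoose
  rw [Real.Gamma_add_one (two_mul_add_two_mul_ne_zero hα hα₀ k)]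
  linear_combination (2 * k + 2 * α) * gegenbauer_two_mul_eval_zero hα hα₀ k -
    2 * (-1) ^ k * (2 * k).factorial * Real.Gamma (2 * α) * hchoose

theorem caseFactor_of_even (hα : -(1 / 2 : ℝ) < α) (hα₀ : α < 0) {n : ℕ} (hn : Even n) :
    caseFactor α n = √(((n : ℝ) + 1) / (n + 1 + 2 * α)) * |(gegenbauer α n).eval 0| := by
  obtain ⟨k, rfl⟩ := even_iff_exists_two_mul.mp hn
  have hpos := add_one_add_two_mul_pos hα (2 * k)
  have hΓ : 0 < Real.Gamma (((2 * k : ℕ) : ℝ) + 1 + 2 * α) := Real.Gamma_pos_of_pos hpos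
  have hzero := congrArg abs (gegenbauer_two_mul_eval_zero_mul_Gamma_add_one hα hα₀.ne k)
  rw [show 2 * (k : ℝ) + 2 * α + 1 = ((2 * k : ℕ) : ℝ) + 1 + 2 * α by push_cast; ring] at hzero
  simp only [abs_mul, abs_pow, abs_neg, abs_one, one_pow, one_mul, abs_two, Nat.abs_cast,
    abs_of_pos hΓ] at hzero
  have hhalf : ((2 * k : ℕ) : ℝ) / 2 = k := by push_cast; ring
  rw [caseFactor, if_neg hα₀.not_ge, if_pos hn, hhalf, Nat.mul_div_cancel_left k two_pos,
    add_comm (1 : ℝ), Real.sqrt_mul (by positivity), Real.sqrt_div (by positivity),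
    Nat.factorial_succ, Nat.cast_mul, Nat.cast_succ, div_mul_eq_mul_div,
    div_eq_div_iff (by positivity) (by positivity)]
  have hsq := Real.mul_self_sqrt (by positivity : 0 ≤ ((2 * k : ℕ) : ℝ) + 1)
  linear_combination -√(((2 * k : ℕ) : ℝ) + 1 + 2 * α) *
    ((((2 * k : ℕ) : ℝ) + 1) * hzero +
      |(gegenbauer α (2 * k)).eval 0| * Real.Gamma (((2 * k : ℕ) : ℝ) + 1 + 2 * α) * hsq)

theorem caseFactor_of_odd (hα : -(1 / 2 : ℝ) < α) (hα₀ : α < 0) {n : ℕ} (hn : Odd n) :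
    caseFactor α n = |(gegenbauer α (n + 1)).eval 0| := by
  obtain ⟨k, rfl⟩ := hn
  have hpos := add_one_add_two_mul_pos hα (2 * k + 1)
  have hΓ : 0 < Real.Gamma (((2 * k + 1 : ℕ) : ℝ) + 1 + 2 * α) := Real.Gamma_pos_of_pos hpos
  have hzero := congrArg abs (gegenbauer_two_mul_eval_zero hα hα₀.ne (k + 1))
  rw [show 2 * ((k + 1 : ℕ) : ℝ) + 2 * α = ((2 * k + 1 : ℕ) : ℝ) + 1 + 2 * α by push_cast; ring,
    show ((k + 1 : ℕ) : ℝ) + α - 1 = k + α by push_cast; ring] at hzero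
  simp only [abs_mul, abs_pow, abs_neg, abs_one, one_pow, one_mul, Nat.abs_cast,
    abs_of_pos hΓ, mul_add_one] at hzero
  have hhalf : (((2 * k + 1 : ℕ) : ℝ) - 1) / 2 = k := by push_cast; ring
  rw [caseFactor, if_neg hα₀.not_ge, if_neg (Nat.not_even_two_mul_add_one k), hhalf,
    show (2 * k + 1 + 1) / 2 = k + 1 by omega, add_comm (1 : ℝ), ← hzero,
    mul_div_cancel_right₀ _ hΓ.ne']

theorem abs_gegenbauer_succ_eval_le_caseFactor (hα : -(1 / 2 : ℝ) < α) (n : ℕ) {x : ℝ}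
    (hx : |x| ≤ 1) : |(gegenbauer α (n + 1)).eval x| ≤ caseFactor α n := by
  rcases le_or_gt 0 α with hα₀ | hα₀
  · rw [caseFactor, if_pos hα₀]
    exact abs_gegenbauer_eval_le_one hα₀ (n + 1) hx
  rcases Nat.even_or_odd n with hn | hn
  · rw [caseFactor_of_even hα hα₀ hn]
    exact abs_gegenbauer_eval_le_of_even hα hα₀.le hn hx
  · rw [caseFactor_of_odd hα hα₀ hn]
    exact abs_gegenbauer_eval_le_of_odd hα hα₀.le hn hx

theorem natDegree_gegenbauer_le (m : ℕ) : (gegenbauer α m).natDegree ≤ m := by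
  induction m using Nat.twoStepInduction with
  | zero => simp [gegenbauer]
  | one => simp [gegenbauer]
  | more m h₀ h₁ =>
    rw [gegenbauer, mul_assoc]
    refine (natDegree_sub_le _ _).trans (max_le ?_ ?_)
    · exact (natDegree_C_mul_le _ _).trans
        ((natDegree_mul_le_of_le natDegree_X_le h₁).trans (by omega))
    · exact (natDegree_C_mul_le _ _).trans (h₀.trans (Nat.le_add_right m 2))

theorem coeff_gegenbauer_succ_mul_Gamma (hα : -(1 / 2 : ℝ) < α) (m : ℕ) :
    (gegenbauer α (m + 1)).coeff (m + 1) * (Real.Gamma (1 + m + 2 * α) * Real.Gamma (1 + α)) =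
      2 ^ m * Real.Gamma (1 + m + α) * Real.Gamma (1 + 2 * α) := by
  induction m with
  | zero => simp [gegenbauer, mul_comm]
  | succ m ih =>
    have hpos := add_one_add_two_mul_pos hα m
    have : (0 : ℝ) ≤ m := m.cast_nonneg
    have hcoeff : (m + 1 + 2 * α) * (gegenbauer α (m + 2)).coeff (m + 2) =
        2 * (m + 1 + α) * (gegenbauer α (m + 1)).coeff (m + 1) := by
      have hlow : (gegenbauer α m).coeff (m + 2) = 0 :=
        coeff_eq_zero_of_natDegree_lt (by have := natDegree_gegenbauer_le (α := α) m; omega)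
      rw [gegenbauer, mul_assoc, coeff_sub, coeff_C_mul, coeff_X_mul, coeff_C_mul, hlow]
      field_simp
      ring
    have hΓ (a : ℝ) (ha : -1 < a) : Real.Gamma (1 + ((m + 1 : ℕ) : ℝ) + a) =
        (1 + m + a) * Real.Gamma (1 + m + a) := by
      rw [← Real.Gamma_add_one (by linarith)]
      push_cast
      ring_nf
    rw [hΓ _ (by linarith), hΓ _ (by linarith), pow_succ]
    linear_combination Real.Gamma (1 + m + 2 * α) * Real.Gamma (1 + α) * hcoeff +
      2 * (m + 1 + α) * ih

theorem natDegree_gegenbauer_succ (hα : -(1 / 2 : ℝ) < α) (m : ℕ) :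
    (gegenbauer α (m + 1)).natDegree = m + 1 := by
  have : (0 : ℝ) ≤ m := m.cast_nonneg
  refine natDegree_eq_of_le_of_coeff_ne_zero (natDegree_gegenbauer_le _) fun hzero => ?_
  have hcoeff := coeff_gegenbauer_succ_mul_Gamma hα m
  have h₁ := Real.Gamma_pos_of_pos (by linarith : 0 < 1 + (m : ℝ) + α)
  have h₂ := Real.Gamma_pos_of_pos (by linarith : 0 < 1 + 2 * α)
  rw [hzero, zero_mul] at hcoeff
  exact (by positivity : 2 ^ m * Real.Gamma (1 + m + α) * Real.Gamma (1 + 2 * α) ≠ 0) hcoeff.symm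

theorem leadingCoeff_gegenbauer_succ (hα : -(1 / 2 : ℝ) < α) (m : ℕ) :
    (gegenbauer α (m + 1)).leadingCoeff =
      2 ^ m * Real.Gamma (1 + m + α) * Real.Gamma (1 + 2 * α) /
        (Real.Gamma (1 + m + 2 * α) * Real.Gamma (1 + α)) := by
  have : (0 : ℝ) ≤ m := m.cast_nonneg
  have h₁ := Real.Gamma_pos_of_pos (by linarith : 0 < 1 + (m : ℝ) + 2 * α)
  have h₂ := Real.Gamma_pos_of_pos (by linarith : 0 < 1 + α)
  rw [leadingCoeff, natDegree_gegenbauer_succ hα, eq_div_iff (by positivity),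
    coeff_gegenbauer_succ_mul_Gamma hα]

end Gegenbauer

section ShiftedGegenbauerNodes

theorem eq_C_leadingCoeff_mul_nodal {F ι : Type*} [Field F] {s : Finset ι} {v : ι → F}
    (hv : Set.InjOn v s) {p : F[X]} (hdeg : p.natDegree = s.card)
    (hroot : ∀ i ∈ s, p.eval (v i) = 0) : p = C p.leadingCoeff * Lagrange.nodal s v := by
  rcases eq_or_ne p 0 with rfl | hp
  · simp
  have hdegree : p.degree = s.card := by rw [degree_eq_natDegree hp, hdeg]
  refine Polynomial.eq_of_degree_le_of_eval_index_eq s hv hdegree.le ?_ ?_ fun i hi => ?_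
  · rw [degree_C_mul (leadingCoeff_ne_zero.mpr hp), Lagrange.degree_nodal, hdegree]
  · rw [leadingCoeff_mul, leadingCoeff_C, Lagrange.nodal_monic.leadingCoeff, mul_one]
  · rw [hroot i hi, eval_mul, Lagrange.eval_nodal_at_node hi, mul_zero]

variable {l α : ℝ} {n : ℕ}

theorem natDegree_two_div_mul_X_sub_one (hl : l ≠ 0) :
    (C (2 / l) * X - 1 : ℝ[X]).natDegree = 1 := by
  rw [← C_1, natDegree_sub_C, natDegree_C_mul_X _ (div_ne_zero two_ne_zero hl)]

theorem natDegree_shiftedGegenbauer_succ (hl : l ≠ 0) (hα : -(1 / 2 : ℝ) < α) (m : ℕ) :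
    (shiftedGegenbauer l α (m + 1)).natDegree = m + 1 := by
  rw [shiftedGegenbauer, natDegree_comp, natDegree_two_div_mul_X_sub_one hl, mul_one,
    natDegree_gegenbauer_succ hα]

theorem leadingCoeff_shiftedGegenbauer_succ (hl : l ≠ 0) (hα : -(1 / 2 : ℝ) < α) (m : ℕ) :
    (shiftedGegenbauer l α (m + 1)).leadingCoeff =
      2 ^ (2 * m + 1) * Real.Gamma (1 + m + α) * Real.Gamma (1 + 2 * α) /
        (l ^ (m + 1) * Real.Gamma (1 + m + 2 * α) * Real.Gamma (1 + α)) := by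
  have hdeg := natDegree_two_div_mul_X_sub_one hl
  have hlead : (C (2 / l) * X - 1 : ℝ[X]).leadingCoeff = 2 / l := by
    simp [leadingCoeff, hdeg, coeff_one]
  rw [shiftedGegenbauer, leadingCoeff_comp (hdeg.trans_ne one_ne_zero), hlead,
    natDegree_gegenbauer_succ hα, leadingCoeff_gegenbauer_succ hα, div_pow, div_mul_div_comm]
  ring

theorem leadingCoeff_shiftedGegenbauer_succ_pos (hl : 0 < l) (hα : -(1 / 2 : ℝ) < α) (m : ℕ) :
    0 < (shiftedGegenbauer l α (m + 1)).leadingCoeff := by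
  have : (0 : ℝ) ≤ m := m.cast_nonneg
  have h₁ := Real.Gamma_pos_of_pos (by linarith : 0 < 1 + (m : ℝ) + α)
  have h₂ := Real.Gamma_pos_of_pos (by linarith : 0 < 1 + 2 * α)
  have h₃ := Real.Gamma_pos_of_pos (by linarith : 0 < 1 + (m : ℝ) + 2 * α)
  have h₄ := Real.Gamma_pos_of_pos (by linarith : 0 < 1 + α)
  rw [leadingCoeff_shiftedGegenbauer_succ hl.ne' hα]
  positivity

theorem eval_shiftedGegenbauer (l α : ℝ) (m : ℕ) (t : ℝ) :
    (shiftedGegenbauer l α m).eval t = (gegenbauer α m).eval (2 / l * t - 1) := by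
  simp [shiftedGegenbauer, eval_comp]

theorem abs_two_div_mul_sub_one (hl : 0 < l) (t : ℝ) : |2 / l * t - 1| = |2 * t - l| / l := by
  rw [← abs_of_pos hl, ← abs_div, abs_of_pos hl]
  congr 1
  field_simp

namespace IsSGGNodes

variable {x : Fin (n + 1) → ℝ}

theorem isRoot (hx : IsSGGNodes l α n x) (i : Fin (n + 1)) :
    (shiftedGegenbauer l α (n + 1)).IsRoot (x i) :=
  hx.2.subset (Set.mem_range_self i)

theorem mem_Ioo (hl : 0 < l) (hα : -(1 / 2 : ℝ) < α) (hx : IsSGGNodes l α n x)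
    (i : Fin (n + 1)) : x i ∈ Set.Ioo 0 l := by
  have hroot := hx.isRoot i
  rw [IsRoot.def, eval_shiftedGegenbauer] at hroot
  have hlt := abs_lt_one_of_isRoot_gegenbauer hα hroot
  rw [abs_two_div_mul_sub_one hl, div_lt_one hl, abs_lt] at hlt
  constructor <;> linarith

theorem shiftedGegenbauer_eq (hl : l ≠ 0) (hα : -(1 / 2 : ℝ) < α) (hx : IsSGGNodes l α n x) :
    shiftedGegenbauer l α (n + 1) =
      C (shiftedGegenbauer l α (n + 1)).leadingCoeff * Lagrange.nodal Finset.univ x := by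
  refine eq_C_leadingCoeff_mul_nodal hx.1.injective.injOn ?_ fun i _ => hx.isRoot i
  rw [natDegree_shiftedGegenbauer_succ hl hα, Finset.card_fin]

theorem abs_nodal_eval_le (hl : 0 < l) (hα : -(1 / 2 : ℝ) < α) (hx : IsSGGNodes l α n x) {t : ℝ}
    (ht : t ∈ Set.Icc 0 l) :
    |(Lagrange.nodal Finset.univ x).eval t| ≤
      caseFactor α n / (shiftedGegenbauer l α (n + 1)).leadingCoeff := by
  have hlead := leadingCoeff_shiftedGegenbauer_succ_pos hl hα n
  have hmem : |2 / l * t - 1| ≤ 1 := by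
    rw [abs_two_div_mul_sub_one hl, div_le_one hl, abs_le]
    constructor <;> linarith [ht.1, ht.2]
  have heval := congrArg (fun p => |p.eval t|) (hx.shiftedGegenbauer_eq hl.ne' hα)
  simp only [eval_mul, eval_C, abs_mul, abs_of_pos hlead, eval_shiftedGegenbauer] at heval
  rw [le_div_iff₀' hlead, ← heval]
  exact abs_gegenbauer_succ_eval_le_caseFactor hα n hmem

end IsSGGNodes

end ShiftedGegenbauerNodes

section RepeatedIntegration

variable {f g : ℝ → ℝ}

theorem continuous_foldIntegral (hf : Continuous f) (q : ℕ) : Continuous (foldIntegral f q) := by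
  induction q with
  | zero => exact hf
  | succ q ih =>
    exact intervalIntegral.continuous_primitive (fun _ _ => ih.intervalIntegrable _ _) 0

theorem hasDerivAt_foldIntegral_succ (hf : Continuous f) (q : ℕ) (t : ℝ) :
    HasDerivAt (foldIntegral f (q + 1)) (foldIntegral f q t) t :=
  (continuous_foldIntegral hf q).integral_hasStrictDerivAt 0 t |>.hasDerivAt

theorem foldIntegral_succ_zero (f : ℝ → ℝ) (q : ℕ) : foldIntegral f (q + 1) 0 = 0 :=
  intervalIntegral.integral_same

theorem foldIntegral_congr {t : ℝ} (ht : 0 ≤ t) (h : Set.EqOn f g (Set.Icc 0 t)) (q : ℕ) :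
    foldIntegral f q t = foldIntegral g q t := by
  induction q generalizing t with
  | zero => exact h (Set.right_mem_Icc.mpr ht)
  | succ q ih =>
    refine intervalIntegral.integral_congr fun s hs => ?_
    rw [Set.uIcc_of_le ht] at hs
    exact ih hs.1 (h.mono (Set.Icc_subset_Icc_right hs.2))

theorem integral_sub_pow_mul_foldIntegral (hf : Continuous f) (k q : ℕ) (t : ℝ) :
    ∫ s in (0 : ℝ)..t, (t - s) ^ k * foldIntegral f q s =
      k.factorial * foldIntegral f (q + k + 1) t := by
  induction k generalizing q with
  | zero => simp [foldIntegral]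
  | succ k ih =>
    have hpow (s : ℝ) : HasDerivAt (fun s => (t - s) ^ (k + 1)) (-((k + 1 : ℝ) * (t - s) ^ k)) s :=
      ((hasDerivAt_id s).const_sub t).fun_pow (k + 1) |>.congr_deriv (by simp)
    calc ∫ s in (0 : ℝ)..t, (t - s) ^ (k + 1) * foldIntegral f q s
        = ∫ s in (0 : ℝ)..t, (k + 1 : ℝ) * ((t - s) ^ k * foldIntegral f (q + 1) s) := by
          rw [intervalIntegral.integral_mul_deriv_eq_deriv_mul (fun s _ => hpow s)
            (fun s _ => hasDerivAt_foldIntegral_succ hf q s)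
            (Continuous.intervalIntegrable (by fun_prop) _ _)
            ((continuous_foldIntegral hf q).intervalIntegrable _ _)]
          simp [foldIntegral_succ_zero, mul_assoc]
      _ = (k + 1).factorial * foldIntegral f (q + (k + 1) + 1) t := by
          rw [intervalIntegral.integral_const_mul, ih, Nat.factorial_succ,
            show q + 1 + k + 1 = q + (k + 1) + 1 by ring]
          push_cast
          ring

theorem foldIntegral_succ_eq_integral {t : ℝ} (ht : 0 ≤ t) (hf : ContinuousOn f (Set.Icc 0 t))
    (k : ℕ) :
    foldIntegral f (k + 1) t = (k.factorial : ℝ)⁻¹ * ∫ s in (0 : ℝ)..t, (t - s) ^ k * f s := by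
  let F : ℝ → ℝ := Set.IccExtend ht ((Set.Icc 0 t).domRestrict f)
  have hF : Continuous F := hf.domRestrict.Icc_extend'
  have hfF : Set.EqOn f F (Set.Icc 0 t) := fun s hs =>
    (Set.IccExtend_of_mem ht ((Set.Icc 0 t).domRestrict f) hs).symm
  have hintegral : ∫ s in (0 : ℝ)..t, (t - s) ^ k * f s =
      ∫ s in (0 : ℝ)..t, (t - s) ^ k * foldIntegral F 0 s := by
    refine intervalIntegral.integral_congr fun s hs => ?_
    rw [Set.uIcc_of_le ht] at hs
    simp only [foldIntegral, hfF hs]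
  rw [hintegral, integral_sub_pow_mul_foldIntegral hF, zero_add, ← foldIntegral_congr ht hfF,
    inv_mul_cancel_left₀ (by positivity)]

end RepeatedIntegration

section Quadrature

theorem eval_basis_mul_add {F ι : Type*} [Field F] [DecidableEq ι] {a : F} (ha : a ≠ 0)
    (b : F) (s : Finset ι) (v : ι → F) (i : ι) (t : F) :
    (Lagrange.basis s (fun j => a * v j + b) i).eval (a * t + b) =
      (Lagrange.basis s v i).eval t := by
  simp only [Lagrange.basis, Lagrange.basisDivisor, eval_prod, eval_mul, eval_sub, eval_C, eval_X,
    add_sub_add_right_eq_sub, ← mul_sub, mul_inv]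
  exact Finset.prod_congr rfl fun j _ => by field_simp

variable {n : ℕ} {l : ℝ}

theorem bsgim_succ_apply (hl : l ≠ 0) (x : Fin (n + 1) → ℝ) (k : ℕ) (i j : Fin (n + 1)) :
    bsgim l x (k + 1) i j = (k.factorial : ℝ)⁻¹ * ((x i - x j) ^ k *
      ∫ s in (0 : ℝ)..(x i), (Lagrange.basis Finset.univ x j).eval s) := by
  have hz : (fun j => 2 * x j / l - 1) = fun j => 2 / l * x j + -1 := by
    ext j
    ring
  have hscale : l / 2 * ∫ t in (-1 : ℝ)..(2 / l * x i + -1),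
      (Lagrange.basis Finset.univ (fun j => 2 / l * x j + -1) j).eval t =
      ∫ s in (0 : ℝ)..(x i), (Lagrange.basis Finset.univ x j).eval s := by
    have hsubst := intervalIntegral.smul_integral_comp_mul_add (a := 0) (b := x i)
      (fun t => (Lagrange.basis Finset.univ (fun j => 2 / l * x j + -1) j).eval t) (2 / l) (-1)
    simp only [eval_basis_mul_add (div_ne_zero two_ne_zero hl), mul_zero, zero_add,
      smul_eq_mul] at hsubst
    rw [← hsubst]
    field_simp
  have hpow : (l / 2) ^ k * (2 / l * x i + -1 - (2 / l * x j + -1)) ^ k = (x i - x j) ^ k := by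
    rw [← mul_pow]
    congr 1
    field_simp
    ring
  rw [bsgim, hz, gim, Matrix.smul_apply, Matrix.of_apply, Nat.add_sub_cancel, smul_eq_mul,
    ← hscale, ← hpow, pow_succ]
  simp only [lagrangeBasis]
  ring

theorem bsgqError_succ_eq_integral (hl : l ≠ 0) (x : Fin (n + 1) → ℝ) (k : ℕ) {f : ℝ → ℝ}
    {i : Fin (n + 1)} (hi : 0 ≤ x i) (hf : ContinuousOn f (Set.Icc 0 (x i))) :
    bsgqError l x (k + 1) f i = (k.factorial : ℝ)⁻¹ * ∫ s in (0 : ℝ)..(x i),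
      ((x i - s) ^ k * f s -
        (Lagrange.interpolate Finset.univ x fun j => (x i - x j) ^ k * f (x j)).eval s) := by
  have hquad : (bsgim l x (k + 1)).mulVec (fun j => f (x j)) i = (k.factorial : ℝ)⁻¹ *
      ∫ s in (0 : ℝ)..(x i),
        (Lagrange.interpolate Finset.univ x fun j => (x i - x j) ^ k * f (x j)).eval s := by
    simp only [Matrix.mulVec, dotProduct, Lagrange.interpolate_apply,
      eval_finsetSum, eval_mul, eval_C]
    rw [intervalIntegral.integral_finsetSum
      fun j _ => Continuous.intervalIntegrable (by fun_prop) _ _, Finset.mul_sum]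
    refine Finset.sum_congr rfl fun j _ => ?_
    rw [bsgim_succ_apply hl, intervalIntegral.integral_const_mul]
    ring
  have hkernel : ContinuousOn (fun s => (x i - s) ^ k * f s) (Set.uIcc 0 (x i)) := by
    rw [Set.uIcc_of_le hi]
    exact ContinuousOn.mul (by fun_prop) hf
  rw [intervalIntegral.integral_sub hkernel.intervalIntegrable
    ((Polynomial.continuous _).intervalIntegrable _ _), mul_sub, bsgqError, hquad,
    foldIntegral_succ_eq_integral hi hf]

end Quadrature

section InterpolationRemainder

variable {a b : ℝ} {g : ℝ → ℝ}

theorem exists_derivWithin_eq_zero {c d : ℝ} (hcd : c < d) (hc : a ≤ c) (hd : d ≤ b)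
    (hg : ContinuousOn g (Set.Icc a b)) (hgcd : g c = g d) :
    ∃ ζ ∈ Set.Ioo c d, derivWithin g (Set.Icc a b) ζ = 0 := by
  obtain ⟨ζ, hζ, hderiv⟩ := exists_deriv_eq_zero hcd (hg.mono (Set.Icc_subset_Icc hc hd)) hgcd
  have hnhds := Icc_mem_nhds (hc.trans_lt hζ.1) (hζ.2.trans_le hd)
  exact ⟨ζ, hζ, (derivWithin_of_mem_nhds hnhds).trans hderiv⟩

theorem exists_iteratedDerivWithin_eq_zero_of_strictMono {N : ℕ}
    (hg : ContDiffOn ℝ (N + 1 : ℕ) g (Set.Icc a b)) {y : Fin (N + 2) → ℝ} (hy : StrictMono y)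
    (hmem : ∀ i, y i ∈ Set.Icc a b) (hzero : ∀ i, g (y i) = 0) :
    ∃ ζ ∈ Set.Ioo a b, iteratedDerivWithin (N + 1) g (Set.Icc a b) ζ = 0 := by
  have hab : a < b := (hmem 0).1.trans_lt ((hy Fin.zero_lt_one).trans_le (hmem 1).2)
  induction N generalizing g with
  | zero =>
    obtain ⟨ζ, hζ, hderiv⟩ := exists_derivWithin_eq_zero (hy Fin.zero_lt_one) (hmem 0).1 (hmem 1).2
      hg.continuousOn ((hzero 0).trans (hzero 1).symm)
    exact ⟨ζ, ⟨(hmem 0).1.trans_lt hζ.1, hζ.2.trans_le (hmem 1).2⟩, by simpa using hderiv⟩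
  | succ N ih =>
    have hrolle (i : Fin (N + 2)) : ∃ ζ ∈ Set.Ioo (y i.castSucc) (y i.succ),
        derivWithin g (Set.Icc a b) ζ = 0 :=
      exists_derivWithin_eq_zero (hy i.castSucc_lt_succ) (hmem _).1 (hmem _).2 hg.continuousOn
        ((hzero _).trans (hzero _).symm)
    choose c hc hderiv using hrolle
    rw [iteratedDerivWithin_succ']
    refine ih (hg.derivWithin (uniqueDiffOn_Icc hab) (by norm_cast)) ?_
      (fun i => ⟨(hmem _).1.trans (hc i).1.le, (hc i).2.le.trans (hmem _).2⟩) hderiv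
    exact Fin.strictMono_iff_lt_succ.mpr fun i => (hc i.castSucc).2.trans (hc i.succ).1

theorem iterate_derivative_eq_C_of_natDegree_le {R : Type*} [Semiring R] {p : R[X]} {n : ℕ}
    (hp : p.natDegree ≤ n) : derivative^[n] p = C (n.factorial * p.coeff n) := by
  ext (_ | m)
  · simp [coeff_iterate_derivative, Nat.descFactorial_self]
  · rw [coeff_iterate_derivative, coeff_eq_zero_of_natDegree_lt (by omega), smul_zero, coeff_C_succ]

theorem iteratedDeriv_polynomial_eval {𝕜 : Type*} [NontriviallyNormedField 𝕜] (p : 𝕜[X]) (k : ℕ)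
    (t : 𝕜) : iteratedDeriv k (fun t => p.eval t) t = (derivative^[k] p).eval t := by
  induction k generalizing t with
  | zero => simp
  | succ k ih =>
    rw [iteratedDeriv_succ, funext ih, Function.iterate_succ_apply', Polynomial.deriv]

theorem exists_iteratedDerivWithin_eq_factorial_mul_coeff (hab : a < b) {N : ℕ}
    (hg : ContDiffOn ℝ (N + 1 : ℕ) g (Set.Icc a b)) {p : ℝ[X]} (hp : p.natDegree ≤ N + 1)
    {t : Finset ℝ} (ht : t.card = N + 2) (hmem : ∀ y ∈ t, y ∈ Set.Icc a b)
    (heq : ∀ y ∈ t, p.eval y = g y) :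
    ∃ ζ ∈ Set.Ioo a b,
      iteratedDerivWithin (N + 1) g (Set.Icc a b) ζ = (N + 1).factorial * p.coeff (N + 1) := by
  have hp' : ContDiff ℝ (N + 1 : ℕ) (fun y => p.eval y) := p.contDiff_aeval _
  have hyt (i : Fin (N + 2)) : t.orderEmbOfFin ht i ∈ t := t.orderEmbOfFin_mem ht i
  obtain ⟨ζ, hζ, hzero⟩ := exists_iteratedDerivWithin_eq_zero_of_strictMono
    (g := g - fun y => p.eval y) (hg.sub hp'.contDiffOn) (t.orderEmbOfFin ht).strictMono
    (fun i => hmem _ (hyt i)) (fun i => sub_eq_zero.mpr (heq _ (hyt i)).symm)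
  have hζ' := Set.Ioo_subset_Icc_self hζ
  have hu := uniqueDiffOn_Icc hab
  rw [iteratedDerivWithin_sub hζ' hu (hg ζ hζ') hp'.contDiffWithinAt,
    iteratedDerivWithin_eq_iteratedDeriv hu hp'.contDiffAt hζ', iteratedDeriv_polynomial_eval,
    iterate_derivative_eq_C_of_natDegree_le hp, eval_C] at hzero
  exact ⟨ζ, hζ, sub_eq_zero.mp hzero⟩

theorem exists_sub_eval_interpolate_eq (hab : a < b) {ι : Type*} [DecidableEq ι] {s : Finset ι}
    {v : ι → ℝ} {n : ℕ} (hs : s.card = n + 1) (hv : Set.InjOn v s)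
    (hmem : ∀ i ∈ s, v i ∈ Set.Icc a b) (hg : ContDiffOn ℝ (n + 1 : ℕ) g (Set.Icc a b)) {τ : ℝ}
    (hτ : τ ∈ Set.Icc a b) :
    ∃ ζ ∈ Set.Ioo a b, g τ - (Lagrange.interpolate s v fun i => g (v i)).eval τ =
      iteratedDerivWithin (n + 1) g (Set.Icc a b) ζ / ((n + 1).factorial : ℝ) *
        (Lagrange.nodal s v).eval τ := by
  by_cases hnode : τ ∈ s.image v
  · obtain ⟨i, hi, rfl⟩ := Finset.mem_image.mp hnode
    obtain ⟨ζ, hζ⟩ := Set.nonempty_Ioo.mpr hab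
    exact ⟨ζ, hζ, by rw [Lagrange.eval_interpolate_at_node _ hv hi,
      Lagrange.eval_nodal_at_node hi, sub_self, mul_zero]⟩
  set P := Lagrange.interpolate s v fun i => g (v i)
  set ω := Lagrange.nodal s v
  have hω : ω.eval τ ≠ 0 := Lagrange.eval_nodal_not_at_node fun i hi h =>
    hnode (Finset.mem_image.mpr ⟨i, hi, h.symm⟩)
  have hPdeg : P.degree < (n + 1 : ℕ) := hs ▸ Lagrange.degree_interpolate_lt _ hv
  have hωdeg : ω.natDegree = n + 1 := Lagrange.natDegree_nodal.trans hs
  -- `Q` interpolates `g` at the additional node `τ` as well.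
  set c := (g τ - P.eval τ) / ω.eval τ with hc
  set Q := P + C c * ω
  have hQdeg : Q.natDegree ≤ n + 1 :=
    natDegree_add_le_of_degree_le (natDegree_le_of_degree_le hPdeg.le)
      ((natDegree_C_mul_le _ _).trans hωdeg.le)
  have hQcoeff : Q.coeff (n + 1) = c := by
    rw [coeff_add, coeff_eq_zero_of_degree_lt hPdeg, coeff_C_mul, ← hωdeg,
      (Lagrange.nodal_monic : ω.Monic).coeff_natDegree, zero_add, mul_one]
  obtain ⟨ζ, hζ, hderiv⟩ := exists_iteratedDerivWithin_eq_factorial_mul_coeff hab hg hQdeg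
    (t := insert τ (s.image v))
    (by rw [Finset.card_insert_of_notMem hnode, Finset.card_image_of_injOn hv, hs])
    (by simpa using ⟨hτ, hmem⟩) <| by
      simp only [Finset.forall_mem_insert, Finset.forall_mem_image]
      refine ⟨by simp [Q, hc, hω], fun i hi => ?_⟩
      rw [eval_add, eval_mul, eval_C, Lagrange.eval_interpolate_at_node _ hv hi,
        Lagrange.eval_nodal_at_node hi, mul_zero, add_zero]
  refine ⟨ζ, hζ, ?_⟩
  rw [hderiv, hQcoeff, hc]
  field_simp

end InterpolationRemainder

section LeibnizBound

theorem norm_iteratedDerivWithin_mul_le_two_pow_mul {𝕜 A : Type*} [NontriviallyNormedField 𝕜]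
    [NormedRing A] [NormedAlgebra 𝕜 A] {f g : 𝕜 → A} {s : Set 𝕜} {t : 𝕜} {N : ℕ} {B : ℝ}
    (hf : ContDiffOn 𝕜 N f s) (hg : ContDiffOn 𝕜 N g s) (hs : UniqueDiffOn 𝕜 s) (ht : t ∈ s)
    (hB : ∀ i ≤ N, ‖iteratedDerivWithin i f s t‖ * ‖iteratedDerivWithin (N - i) g s t‖ ≤ B) :
    ‖iteratedDerivWithin N (fun y => f y * g y) s t‖ ≤ 2 ^ N * B := by
  have hleibniz := norm_iteratedFDerivWithin_mul_le hf hg hs ht le_rfl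
  simp only [norm_iteratedFDerivWithin_eq_norm_iteratedDerivWithin, mul_assoc] at hleibniz
  calc ‖iteratedDerivWithin N (fun y => f y * g y) s t‖
      ≤ ∑ i ∈ Finset.range (N + 1), (N.choose i : ℝ) *
          (‖iteratedDerivWithin i f s t‖ * ‖iteratedDerivWithin (N - i) g s t‖) := hleibniz
    _ ≤ ∑ i ∈ Finset.range (N + 1), (N.choose i : ℝ) * B :=
        Finset.sum_le_sum fun i hi => mul_le_mul_of_nonneg_left
          (hB i (Finset.mem_range_succ_iff.mp hi)) (Nat.cast_nonneg _)
    _ = 2 ^ N * B := by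
        rw [← Finset.sum_mul, ← Nat.cast_sum, Nat.sum_range_choose, Nat.cast_pow, Nat.cast_ofNat]

theorem abs_iteratedDerivWithin_const_sub_pow {s : Set ℝ} (hs : UniqueDiffOn ℝ s) {t : ℝ}
    (ht : t ∈ s) (x : ℝ) (k i : ℕ) :
    |iteratedDerivWithin i (fun y => (x - y) ^ k) s t| =
      (k.descFactorial i : ℝ) * |x - t| ^ (k - i) := by
  rw [iteratedDerivWithin_eq_iteratedDeriv hs (ContDiff.contDiffAt (by fun_prop)) ht,
    iteratedDeriv_comp_const_sub i (fun y : ℝ => y ^ k) x]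
  simp

theorem nMax_nonneg (n q : ℕ) (x ζ : ℝ) : 0 ≤ nMax n q x ζ :=
  le_max_of_le_left (Nat.cast_nonneg _)

theorem descFactorial_mul_abs_pow_le_nMax {n i : ℕ} (hi : i ≤ n + 1) (k : ℕ) (x ζ : ℝ) :
    (k.descFactorial i : ℝ) * |x - ζ| ^ (k - i) ≤ nMax n (k + 1) x ζ := by
  rcases lt_or_ge k i with h | h
  · rw [Nat.descFactorial_eq_zero_iff_lt.mpr h, Nat.cast_zero, zero_mul]
    exact nMax_nonneg n (k + 1) x ζ
  · have hindex : n + 1 - (n + 1 - i) = i := by omega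
    have hexponent : ((k + 1 : ℕ) : ℤ) - n + ((n + 1 - i : ℕ) : ℤ) - 2 = ((k - i : ℕ) : ℤ) := by
      omega
    refine le_max_of_le_right <| le_of_eq_of_le ?_ <|
      le_ciSup (Set.finite_range _).bddAbove (⟨n + 1 - i, by omega⟩ : Fin (n + 2))
    simp only [hindex]
    rw [hexponent, zpow_natCast, Nat.cast_add_one, add_sub_cancel_right,
      descPochhammer_eval_eq_descFactorial]

theorem abs_iteratedDerivWithin_const_sub_pow_mul_le {f : ℝ → ℝ} {s : Set ℝ} {t A : ℝ} {n : ℕ}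
    (hs : UniqueDiffOn ℝ s) (ht : t ∈ s) (hf : ContDiffOn ℝ (n + 1 : ℕ) f s)
    (hA : ∀ i ≤ n + 1, |iteratedDerivWithin i f s t| ≤ A) (k : ℕ) (x : ℝ) :
    |iteratedDerivWithin (n + 1) (fun y => (x - y) ^ k * f y) s t| ≤
      2 ^ (n + 1) * (nMax n (k + 1) x t * A) := by
  refine norm_iteratedDerivWithin_mul_le_two_pow_mul (ContDiff.contDiffOn (by fun_prop)) hf hs ht
    fun i hi => ?_
  rw [Real.norm_eq_abs, Real.norm_eq_abs, abs_iteratedDerivWithin_const_sub_pow hs ht]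
  exact mul_le_mul (descFactorial_mul_abs_pow_le_nMax hi k x t) (hA _ (Nat.sub_le _ _))
    (abs_nonneg _) (nMax_nonneg _ _ _ _)

end LeibnizBound

theorem exists_bsgqError_succ_eq {l : ℝ} {n : ℕ} {x : Fin (n + 1) → ℝ}
    (hx : Function.Injective x) (hxl : ∀ j, x j ∈ Set.Icc 0 l) {f : ℝ → ℝ}
    (hf : ContDiffOn ℝ (n + 1 : ℕ) f (Set.Icc 0 l)) (k : ℕ) {i : Fin (n + 1)} (hi : 0 < x i) :
    ∃ τ ∈ Set.Icc 0 l, ∃ ζ ∈ Set.Ioo 0 l, bsgqError l x (k + 1) f i =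
      x i / k.factorial * (iteratedDerivWithin (n + 1) (fun s => (x i - s) ^ k * f s)
        (Set.Icc 0 l) ζ / (n + 1).factorial * (Lagrange.nodal Finset.univ x).eval τ) := by
  have hl : 0 < l := hi.trans_le (hxl i).2
  have hg : ContDiffOn ℝ (n + 1 : ℕ) (fun s => (x i - s) ^ k * f s) (Set.Icc 0 l) :=
    ContDiffOn.mul (ContDiff.contDiffOn (by fun_prop)) hf
  have hsub : Set.Icc 0 (x i) ⊆ Set.Icc 0 l := Set.Icc_subset_Icc_right (hxl i).2
  set P := Lagrange.interpolate Finset.univ x fun j => (x i - x j) ^ k * f (x j)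
  have hcont : ContinuousOn (fun s => (x i - s) ^ k * f s - P.eval s) (Set.uIcc 0 (x i)) := by
    rw [Set.uIcc_of_le hi.le]
    exact (hg.continuousOn.mono hsub).sub P.continuousOn
  obtain ⟨τ, hτ, hmean⟩ := exists_eq_interval_average hi.ne hcont
  rw [Set.uIoo_of_le hi.le] at hτ
  rw [interval_average_eq_div, sub_zero, eq_div_iff hi.ne'] at hmean
  have hτl : τ ∈ Set.Icc 0 l := hsub (Set.Ioo_subset_Icc_self hτ)
  obtain ⟨ζ, hζ, hremainder⟩ := exists_sub_eval_interpolate_eq hl (Finset.card_fin (n + 1))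
    hx.injOn (fun j _ => hxl j) hg hτl
  refine ⟨τ, hτl, ζ, hζ, ?_⟩
  rw [bsgqError_succ_eq_integral hl.ne' x k hi.le (hf.continuousOn.mono hsub), ← hmean,
    hremainder]
  ring

theorem mainTheorem5
    (n q : ℕ) (hq : 1 ≤ q)
    (l α : ℝ) (hl : 0 < l) (hα : -(1 / 2 : ℝ) < α)
    (x : Fin (n + 1) → ℝ) (hx : IsSGGNodes l α n x)
    (f : ℝ → ℝ) (hf : ContDiffOn ℝ ((n + 1 : ℕ) : ℕ∞) f (Set.Icc 0 l))
    (Amax : ℝ) (hA : 0 < Amax)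
    (hbound : ∀ k : ℕ, k ≤ n + 1 → ∀ t ∈ Set.Icc (0 : ℝ) l,
      |iteratedDerivWithin k f (Set.Icc 0 l) t| ≤ Amax) :
    ∃ ζ : Fin (n + 1) → ℝ, ∀ i : Fin (n + 1), ζ i ∈ Set.Ioo (0 : ℝ) l ∧
      |bsgqError l x q f i| ≤
        (2 : ℝ) ^ (-(n : ℤ)) * Amax * l ^ (1 + n) * nMax n q (x i) (ζ i) * x i
            * Real.Gamma (1 + α) * Real.Gamma (1 + (n : ℝ) + 2 * α)
          / (((n + 1).factorial : ℝ) * ((q - 1).factorial : ℝ)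
            * Real.Gamma (1 + (n : ℝ) + α) * Real.Gamma (1 + 2 * α))
          * caseFactor α n := by
  obtain ⟨k, rfl⟩ := Nat.exists_eq_add_of_le' hq
  have hx₀ (i : Fin (n + 1)) : x i ∈ Set.Ioo 0 l := hx.mem_Ioo hl hα i
  choose τ hτ ζ hζ herr using fun i => exists_bsgqError_succ_eq hx.1.injective
    (fun j => Set.Ioo_subset_Icc_self (hx₀ j)) hf k (hx₀ i).1
  refine ⟨ζ, fun i => ⟨hζ i, ?_⟩⟩
  have hζi := Set.Ioo_subset_Icc_self (hζ i)
  have hderiv := abs_iteratedDerivWithin_const_sub_pow_mul_le (uniqueDiffOn_Icc hl) hζi hf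
    (fun m hm => hbound m hm (ζ i) hζi) k (x i)
  have hnodal := hx.abs_nodal_eval_le hl hα (hτ i)
  have hxi := (hx₀ i).1
  have := nMax_nonneg n (k + 1) (x i) (ζ i)
  calc |bsgqError l x (k + 1) f i|
      = x i / k.factorial * (|iteratedDerivWithin (n + 1) (fun s => (x i - s) ^ k * f s)
          (Set.Icc 0 l) (ζ i)| / (n + 1).factorial *
            |(Lagrange.nodal Finset.univ x).eval (τ i)|) := by
        simp only [herr, abs_mul, abs_div, abs_of_pos hxi, Nat.abs_cast]
    _ ≤ x i / k.factorial * (2 ^ (n + 1) * (nMax n (k + 1) (x i) (ζ i) * Amax) /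
          (n + 1).factorial * (caseFactor α n / (shiftedGegenbauer l α (n + 1)).leadingCoeff)) := by
        gcongr
    _ = _ := by
        rw [leadingCoeff_shiftedGegenbauer_succ hl.ne' hα, Nat.add_sub_cancel, zpow_neg,
          zpow_natCast]
        field_simp
        ring
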